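/- Let $(t_i)_{i\ge 1}$ be any sequence of positive integers. Define finite groups $X_i$ recursively as follows: $X_1=\mathrm{Alt}(5)$; given $X_i$, let $A_i=\mathrm{Alt}(|X_i|)$, let $W_i=A_i\wr X_i$ be the regular wreath product (the wreathing action being the regular action of $X_i$ on itself), let $S_i$ be the base group of $W_i$, and put \[ X_{i+1}=\{(g_1,\dots,g_{t_i})\in W_i^{t_i} \mid S_ig_1=S_ig_2=\dots=S_ig_{t_i}\}, \] with the natural surjection $X_{i+1}\to X_i$ sending $(g_1,\dots,g_{t_i})$ to the common image of the $g_j$ in $W_i/S_i\cong X_i$. Let $G=\varprojlim X_i$ be the inverse limit, where each $X_i$ is discrete. (The group constructed by A. Lucchini in "A 2-generated just-infinite profinite group which is not positively finitely generated" (2004) is the group $G$ for a particular choice of the integers $t_i$.) Then $G$ is a hereditarily just infinite profinite group, and every countably based profinite group $H$ embeds in $G$ as a closed subgroup, i.e. there is an injective continuous homomorphism $H\to G$ that is a homeomorphism onto a closed subgroup of $G$. Here a profinite group is just infinite if it is infinite and each of its nontrivial closed normal subgroups has finite index; it is hereditarily just infinite if each of its open subgroups (including the group itself) is just infinite; and it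 is countably based if its topology has a countable base. -/

import Mathlib

/-- The `t`-fold subdirect power of the regular wreath product `A ≀ᵣ X`: the tuples
`(g_1, …, g_t)` of elements of `A ≀ᵣ X` that all lie in the same coset of the base group `S`
(the kernel of the projection onto `X`), i.e. `S g_1 = S g_2 = ⋯ = S g_t`. -/
def subdirectPower (A X : Type*) [Group A] [Group X] (t : ℕ) :
    Subgroup (Fin t → A ≀ᵣ X) where
  carrier := {g | ∀ j k, RegularWreathProduct.rightHom (g j) = RegularWreathProduct.rightHom (g k)}
  mul_mem' ha hb j k := by
    rw [Pi.mul_apply, Pi.mul_apply, map_mul, map_mul, ha j k, hb j k]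
  one_mem' _ _ := rfl
  inv_mem' ha j k := by
    rw [Pi.inv_apply, Pi.inv_apply, map_inv, map_inv, ha j k]

/-- The natural map from the subdirect power onto `X`, sending a tuple to the common image of its
entries in `X` (read off from the first entry). -/
def subdirectPowerProj (A X : Type*) [Group A] [Group X] (t : ℕ+) :
    subdirectPower A X t →* X :=
  (RegularWreathProduct.rightHom.comp (Pi.evalMonoidHom (fun _ : Fin t => A ≀ᵣ X) ⟨0, t.pos⟩)).comp
    (subdirectPower A X t).subtype

/-- The finite groups of the construction, with indices starting at `0` instead of `1`:
the first group is `Alt(5)`, and each next group is the `t n`-fold subdirect power of the regular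
wreath product of `Alt(|X|)` by the current group `X`. -/
noncomputable def lucchiniTower (t : ℕ → ℕ+) : ℕ → FiniteGrp.{0}
  | 0 => FiniteGrp.of (alternatingGroup (Fin 5))
  | n + 1 => FiniteGrp.of
      (subdirectPower (alternatingGroup (Fin (Nat.card (lucchiniTower t n))))
        (lucchiniTower t n) (t n))

/-- The natural surjection from each group of the tower onto the preceding one. -/
noncomputable def lucchiniTowerProj (t : ℕ → ℕ+) (n : ℕ) :
    lucchiniTower t (n + 1) →* lucchiniTower t n :=
  subdirectPowerProj (alternatingGroup (Fin (Nat.card (lucchiniTower t n))))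
    (lucchiniTower t n) (t n)

/-- Each finite group of the tower is given the discrete topology. -/
instance lucchiniTowerTopology (t : ℕ → ℕ+) (n : ℕ) : TopologicalSpace (lucchiniTower t n) := ⊥

instance lucchiniTowerDiscrete (t : ℕ → ℕ+) (n : ℕ) : DiscreteTopology (lucchiniTower t n) := ⟨rfl⟩

/-- Lucchini's group: the inverse limit of the tower, realized as the group of compatible
sequences in the product, with the topology induced by the product topology. -/
noncomputable def lucchiniGroup (t : ℕ → ℕ+) : Subgroup (∀ n, lucchiniTower t n) where
  carrier := {x | ∀ n, lucchiniTowerProj t n (x (n + 1)) = x n}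
  mul_mem' ha hb n := by
    rw [Pi.mul_apply, Pi.mul_apply, map_mul, ha n, hb n]
  one_mem' n := map_one _
  inv_mem' ha n := by
    rw [Pi.inv_apply, Pi.inv_apply, map_inv, ha n]

/-- A profinite group is just infinite if it is infinite and every nontrivial closed normal
subgroup has finite index. -/
def IsJustInfinite (G : Type*) [Group G] [TopologicalSpace G] : Prop :=
  Infinite G ∧
    ∀ N : Subgroup G, N.Normal → IsClosed (N : Set G) → N ≠ ⊥ → N.FiniteIndex

/-- A profinite group is hereditarily just infinite if each of its open subgroups (including the
group itself) is just infinite. -/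
def IsHereditarilyJustInfinite (G : Type*) [Group G] [TopologicalSpace G] : Prop :=
  ∀ H : Subgroup G, IsOpen (H : Set G) → IsJustInfinite H

/-! Let K be the kernel of X_{n+1} → X_n, a power of A_n = Alt(|X_n|). Conjugation by an element g
with nontrivial image in X_n permutes the simple factors of K without fixed points, because the
wreathing action is regular. So if k lies in a single factor, the commutator of k and g is
nontrivial there, and a subgroup that contains g and is normalized by K contains K
(`ker_subdirectPowerProj_le`). Hence a nontrivial closed subgroup normalized by an open one has
images containing K at all large n; successive approximation then gives it an open kernel
(`exists_ker_lucchiniGroupProj_le`).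

For universality, X_{n+1} contains A_n × X_n over X_n, so any homomorphism to A_n lifts a
homomorphism to X_n to the next level. Every finite group embeds in A_n for large n, so the lifts
can be chosen to separate points. -/

open scoped commutatorElement

/-- A subgroup of a finite power of a nonabelian simple group that is normal and has a nontrivial
projection to each coordinate is the whole group. -/
theorem Subgroup.eq_top_of_normal_of_forall_exists_apply_ne_one {ι A : Type*} [Finite ι] [Group A]
    [IsSimpleGroup A] (hA : Subgroup.center A = ⊥) (N : Subgroup (ι → A)) [hN : N.Normal]
    (h : ∀ i, ∃ n ∈ N, n i ≠ 1) : N = ⊤ := by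
  classical
  rw [eq_top_iff]
  refine fun x _ ↦ Subgroup.pi_mem_of_mulSingle_mem x fun i ↦ ?_
  have hnormal : (N.comap (MonoidHom.mulSingle (fun _ ↦ A) i)).Normal := hN.comap _
  rcases hnormal.eq_bot_or_eq_top with hbot | htop
  · obtain ⟨n, hn, hni⟩ := h i
    have hnc : n i ∉ Subgroup.center A := by rwa [hA, Subgroup.mem_bot]
    rw [Subgroup.mem_center_iff] at hnc
    push Not at hnc
    obtain ⟨b, hb⟩ := hnc
    -- Commuting with an element supported at `i` kills all other coordinates of `n`.
    have hmem : ⁅b, n i⁆ ∈ N.comap (MonoidHom.mulSingle (fun _ ↦ A) i) := by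
      have hcomm : MonoidHom.mulSingle (fun _ ↦ A) i ⁅b, n i⁆ =
          Pi.mulSingle i b * n * (Pi.mulSingle i b)⁻¹ * n⁻¹ := by
        funext j
        rcases eq_or_ne j i with rfl | hj
        · simp [commutatorElement_def]
        · simp [commutatorElement_def, hj]
      rw [Subgroup.mem_comap, hcomm]
      exact N.mul_mem (hN.conj_mem n hn _) (N.inv_mem hn)
    rw [hbot, Subgroup.mem_bot, commutatorElement_eq_one_iff_mul_comm] at hmem
    exact absurd hmem hb
  · exact htop.ge (Subgroup.mem_top (x i))

/-! ### Subdirect powers of regular wreath products -/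

section SubdirectPower

variable {A X : Type*} [Group A] [Group X] {t : ℕ+}

/-- The inclusion of the product of the base groups into the subdirect power. -/
def subdirectPowerBase (A X : Type*) [Group A] [Group X] (t : ℕ) :
    (Fin t × X → A) →* subdirectPower A X t where
  toFun f := ⟨fun j ↦ ⟨fun x ↦ f (j, x), 1⟩, fun _ _ ↦ rfl⟩
  map_one' := rfl
  map_mul' f f' := by
    ext j x
    · simp
    · simp

theorem subdirectPowerProj_base (f : Fin t × X → A) :
    subdirectPowerProj A X t (subdirectPowerBase A X t f) = 1 := rfl

theorem subdirectPower_right_eq (g : subdirectPower A X t) (j : Fin t) :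
    (g.1 j).right = subdirectPowerProj A X t g := g.2 j ⟨0, t.pos⟩

theorem exists_subdirectPowerBase_eq {g : subdirectPower A X t}
    (hg : subdirectPowerProj A X t g = 1) : ∃ f, subdirectPowerBase A X t f = g := by
  refine ⟨fun p ↦ (g.1 p.1).left p.2, ?_⟩
  ext j x
  · rfl
  · exact ((subdirectPower_right_eq g j).trans hg).symm

/-- If the elements of the kernel of the projection of the subdirect power onto `X` normalize a
subgroup with nontrivial projection, then the subgroup contains this kernel. -/
theorem ker_subdirectPowerProj_le [Finite X] [IsSimpleGroup A] (hA : Subgroup.center A = ⊥)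
    (N : Subgroup (subdirectPower A X t))
    (hN : ∀ n ∈ N, ∀ k ∈ (subdirectPowerProj A X t).ker, k * n * k⁻¹ ∈ N)
    {g : subdirectPower A X t} (hg : g ∈ N) (hg1 : subdirectPowerProj A X t g ≠ 1) :
    (subdirectPowerProj A X t).ker ≤ N := by
  classical
  have hnormal : (N.comap (subdirectPowerBase A X t)).Normal := ⟨fun n hn k ↦ by
    simpa using hN _ hn _ (MonoidHom.mem_ker.2 (subdirectPowerProj_base k))⟩
  suffices htop : N.comap (subdirectPowerBase A X t) = ⊤ by
    intro k hk
    obtain ⟨f, rfl⟩ := exists_subdirectPowerBase_eq (MonoidHom.mem_ker.1 hk)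
    exact htop.ge (Subgroup.mem_top f)
  refine Subgroup.eq_top_of_normal_of_forall_exists_apply_ne_one hA _ fun ⟨j, x⟩ ↦ ?_
  obtain ⟨a, ha⟩ := exists_ne (1 : A)
  set k := subdirectPowerBase A X t (Pi.mulSingle (j, x) a) with hk
  have hmem : k * g * k⁻¹ * g⁻¹ ∈ N :=
    N.mul_mem (hN g hg k (MonoidHom.mem_ker.2 (subdirectPowerProj_base _))) (N.inv_mem hg)
  obtain ⟨f, hf⟩ := exists_subdirectPowerBase_eq (g := k * g * k⁻¹ * g⁻¹) (by
    simp [hk, subdirectPowerProj_base])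
  refine ⟨f, by rwa [Subgroup.mem_comap, hf], ?_⟩
  -- By regularity, `g * k⁻¹ * g⁻¹` is trivial at `(j, x)`, so the commutator has the entry `a`
  -- there.
  have hne : (j, (g.1 j).right⁻¹ * x) ≠ (j, x) := fun h ↦ hg1 <| by
    have := congrArg Prod.snd h
    simpa [subdirectPower_right_eq] using this
  have hval : f (j, x) = ((k * g * k⁻¹ * g⁻¹).1 j).left x := by rw [← hf]; rfl
  have : f (j, x) = a := by
    rw [hval]
    simp [hk, subdirectPowerBase, Pi.mulSingle_eq_of_ne hne]
  rwa [this]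

/-- The subdirect power contains the direct product of `A`, embedded as the diagonal of the base
group, and of the complement `X` of the base group. -/
def subdirectPowerDiag (A X : Type*) [Group A] [Group X] (t : ℕ) :
    A × X →* subdirectPower A X t where
  toFun p := ⟨fun _ ↦ ⟨fun _ ↦ p.1, p.2⟩, fun _ _ ↦ rfl⟩
  map_one' := rfl
  map_mul' _ _ := rfl

theorem subdirectPowerProj_diag (p : A × X) :
    subdirectPowerProj A X t (subdirectPowerDiag A X t p) = p.2 := rfl

theorem subdirectPowerDiag_injective : Function.Injective (subdirectPowerDiag A X t) := by
  intro p q h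
  have h0 := congrFun (congrArg Subtype.val h) ⟨0, t.pos⟩
  exact Prod.ext (congrFun (congrArg RegularWreathProduct.left h0) 1)
    (congrArg RegularWreathProduct.right h0)

theorem card_lt_card_subdirectPower [Finite A] [Finite X] [Nontrivial A] :
    Nat.card X < Nat.card (subdirectPower A X t) := by
  have hinj := (subdirectPowerDiag_injective (A := A) (X := X) (t := t))
  have hcard := Nat.card_le_card_of_injective _ hinj
  rw [Nat.card_prod] at hcard
  have h1 : 1 < Nat.card A := Finite.one_lt_card
  have h2 : 0 < Nat.card X := Nat.card_pos
  nlinarith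

end SubdirectPower

/-- A finite group `Q` embeds in the alternating group of degree `n` as soon as `2 * |Q| ≤ n`. -/
theorem exists_injective_hom_alternatingGroup (Q : Type*) [Group Q] [Finite Q] {n : ℕ}
    (hn : 2 * Nat.card Q ≤ n) :
    ∃ ψ : Q →* alternatingGroup (Fin n), Function.Injective ψ := by
  classical
  have := Fintype.ofFinite Q
  -- Acting on two copies of `Q` squares the sign, so every permutation obtained is even.
  obtain ⟨e⟩ : Nonempty (Q ⊕ Q ↪ Fin n) := Function.Embedding.nonempty_of_card_le (by
    rw [Fintype.card_sum, Fintype.card_fin]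
    rw [Nat.card_eq_fintype_card] at hn
    lia)
  have hsign (q : Q) : Equiv.Perm.sign
      (((MulAction.toPerm q : Equiv.Perm Q).sumCongr (MulAction.toPerm q)).viaEmbedding e) = 1 := by
    rw [Equiv.Perm.viaEmbedding, Equiv.Perm.sign_extendDomain, Equiv.Perm.sign_sumCongr,
      Int.units_mul_self]
  refine ⟨((Equiv.Perm.viaEmbeddingHom e).comp ((Equiv.Perm.sumCongrHom Q Q).comp
    ((MulAction.toPermHom Q Q).prod (MulAction.toPermHom Q Q)))).codRestrict _
      fun q ↦ Equiv.Perm.mem_alternatingGroup.2 (hsign q), ?_⟩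
  rw [MonoidHom.injective_codRestrict]
  refine (Equiv.Perm.viaEmbeddingHom_injective e).comp
    (Equiv.Perm.sumCongrHom_injective.comp fun x y h ↦ ?_)
  exact MulAction.toPerm_injective (congrArg Prod.fst h)

/-- In a second countable profinite group, some countable family of open normal subgroups has
trivial intersection. -/
theorem exists_seq_openNormalSubgroup_forall_mem_imp_eq_one (H : Type*) [Group H]
    [TopologicalSpace H] [IsTopologicalGroup H] [CompactSpace H] [TotallyDisconnectedSpace H]
    [SecondCountableTopology H] :
    ∃ V : ℕ → OpenNormalSubgroup H, ∀ h : H, (∀ k, h ∈ V k) → h = 1 := by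
  obtain ⟨U, hU⟩ := (nhds (1 : H)).exists_antitone_basis
  have hV (k : ℕ) : ∃ V : OpenNormalSubgroup H, (V : Set H) ⊆ U k := by
    obtain ⟨O, hOU, hO, h1⟩ := mem_nhds_iff.1 (hU.1.mem_of_mem (i := k) trivial)
    obtain ⟨V, hV⟩ := ProfiniteGrp.exist_openNormalSubgroup_sub_open_nhds_of_one hO h1
    exact ⟨V, hV.trans hOU⟩
  choose V hV using hV
  refine ⟨V, fun h hh ↦ by_contra fun hne ↦ ?_⟩
  obtain ⟨k, -, hk⟩ := hU.1.mem_iff.1 (compl_singleton_mem_nhds (Ne.symm hne))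
  exact hk (hV k (hh k)) rfl

/-! ### Growth and kernels in the tower -/

section Tower

variable (t : ℕ → ℕ+)

/-- Degree at least 5 makes the alternating groups simple with trivial centre; unbounded degree lets
every finite group embed in them eventually. -/
theorem card_lucchiniTower_lower_bound (n : ℕ) : n + 5 ≤ Nat.card (lucchiniTower t n) := by
  induction n with
  | zero =>
    have h : Nat.card (lucchiniTower t 0) = 60 := by
      change Nat.card (alternatingGroup (Fin 5)) = 60
      rw [nat_card_alternatingGroup]
      simp [Nat.factorial]
    lia
  | succ n ih =>
    have : Nontrivial (alternatingGroup (Fin (Nat.card (lucchiniTower t n)))) :=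
      alternatingGroup.nontrivial_of_three_le_card (by rw [Nat.card_fin]; lia)
    have h : Nat.card (lucchiniTower t n) < Nat.card (lucchiniTower t (n + 1)) :=
      card_lt_card_subdirectPower
    lia

/-- If the elements of the kernel of `lucchiniTowerProj t n` normalize a subgroup with nontrivial
projection, then the subgroup contains this kernel. -/
theorem ker_lucchiniTowerProj_le (n : ℕ) (N : Subgroup (lucchiniTower t (n + 1)))
    (hN : ∀ x ∈ N, ∀ k ∈ (lucchiniTowerProj t n).ker, k * x * k⁻¹ ∈ N)
    {g : lucchiniTower t (n + 1)} (hg : g ∈ N) (hg1 : lucchiniTowerProj t n g ≠ 1) :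
    (lucchiniTowerProj t n).ker ≤ N := by
  have hcard := card_lucchiniTower_lower_bound t n
  have : IsSimpleGroup (alternatingGroup (Fin (Nat.card (lucchiniTower t n)))) :=
    alternatingGroup.isSimpleGroup (by rw [Nat.card_fin]; lia)
  exact ker_subdirectPowerProj_le (alternatingGroup.center_eq_bot (by rw [Nat.card_fin]; lia))
    N hN hg hg1

/-- The extension of a homomorphism to a group of the tower to the next group, by means of a
homomorphism to the alternating group. -/
noncomputable def lucchiniTowerLift {H : Type*} [Group H]
    (ψ : ∀ n, H →* alternatingGroup (Fin (Nat.card (lucchiniTower t n)))) :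
    ∀ n, H →* lucchiniTower t n
  | 0 => 1
  | n + 1 => (subdirectPowerDiag (alternatingGroup (Fin (Nat.card (lucchiniTower t n))))
      (lucchiniTower t n) (t n)).comp ((ψ n).prod (lucchiniTowerLift ψ n))

end Tower

/-! ### The inverse limit and its closed subgroups -/

section Group

variable {t : ℕ → ℕ+}

theorem lucchiniGroup_apply_eq_of_le {g h : lucchiniGroup t} {m n : ℕ} (hmn : m ≤ n)
    (hgh : g.1 n = h.1 n) : g.1 m = h.1 m := by
  induction hmn with
  | refl => exact hgh
  | step _ ih => exact ih (by rw [← g.2, ← h.2, hgh])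

theorem IsOpen.exists_forall_lucchiniGroup_apply_eq {U : Set (lucchiniGroup t)} (hU : IsOpen U)
    {g : lucchiniGroup t} (hg : g ∈ U) : ∃ n, ∀ h : lucchiniGroup t, h.1 n = g.1 n → h ∈ U := by
  obtain ⟨V, hV, rfl⟩ := isOpen_induced_iff.1 hU
  obtain ⟨I, u, hu, hsub⟩ := isOpen_pi_iff.1 hV g.1 hg
  refine ⟨I.sup id, fun h hh ↦ hsub fun i hi ↦ ?_⟩
  have hi' : i ≤ I.sup id := Finset.le_sup (f := id) hi
  rw [lucchiniGroup_apply_eq_of_le hi' hh]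
  exact (hu i hi).2

theorem isClosed_lucchiniGroup : IsClosed (lucchiniGroup t : Set (∀ n, lucchiniTower t n)) := by
  have h : (lucchiniGroup t : Set (∀ n, lucchiniTower t n)) =
      ⋂ n, {x | lucchiniTowerProj t n (x (n + 1)) = x n} := by
    ext x
    simp [lucchiniGroup]
  rw [h]
  exact isClosed_iInter fun n ↦ isClosed_eq
    (continuous_of_discreteTopology.comp (continuous_apply (n + 1))) (continuous_apply n)

instance : CompactSpace (lucchiniGroup t) :=
  isCompact_iff_compactSpace.1 isClosed_lucchiniGroup.isCompact

/-- The projection of Lucchini's group to a group of the tower. -/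
noncomputable def lucchiniGroupProj (t : ℕ → ℕ+) (n : ℕ) : lucchiniGroup t →* lucchiniTower t n :=
  (Pi.evalMonoidHom (fun n ↦ lucchiniTower t n) n).comp (lucchiniGroup t).subtype

theorem lucchiniTowerProj_lucchiniGroupProj (n : ℕ) (g : lucchiniGroup t) :
    lucchiniTowerProj t n (lucchiniGroupProj t (n + 1) g) = lucchiniGroupProj t n g := g.2 n

theorem lucchiniTowerProj_surjective (n : ℕ) : Function.Surjective (lucchiniTowerProj t n) :=
  fun x ↦ ⟨subdirectPowerDiag _ _ _ (1, x), rfl⟩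

/-- Beyond `m`, the values of `f` are discarded and replaced by successive preimages. -/
theorem exists_lucchiniGroup_forall_le_apply_eq (m : ℕ) (f : ∀ n, lucchiniTower t n)
    (hf : ∀ n < m, lucchiniTowerProj t n (f (n + 1)) = f n) :
    ∃ g : lucchiniGroup t, ∀ n ≤ m, g.1 n = f n := by
  classical
  let e : ∀ n, lucchiniTower t n := fun n ↦ Nat.rec (f 0)
    (fun n y ↦ if n + 1 ≤ m then f (n + 1) else (lucchiniTowerProj_surjective n y).choose) n
  have he (n : ℕ) : e (n + 1) = if n + 1 ≤ m then f (n + 1) else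
    (lucchiniTowerProj_surjective n (e n)).choose := rfl
  have hef (n : ℕ) (hn : n ≤ m) : e n = f n := by
    cases n with
    | zero => rfl
    | succ n => rw [he, if_pos hn]
  refine ⟨⟨e, fun n ↦ ?_⟩, hef⟩
  by_cases hn : n + 1 ≤ m
  · rw [hef _ hn, hef n (by lia), hf n (by lia)]
  · rw [he, if_neg hn]
    exact (lucchiniTowerProj_surjective n (e n)).choose_spec

theorem lucchiniGroupProj_surjective (n : ℕ) : Function.Surjective (lucchiniGroupProj t n) := by
  induction n with
  | zero =>
    intro x
    obtain ⟨g, hg⟩ := exists_lucchiniGroup_forall_le_apply_eq 0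
      (Function.update (fun n ↦ (1 : lucchiniTower t n)) 0 x) (by simp)
    exact ⟨g, (hg 0 le_rfl).trans (by simp)⟩
  | succ m ih =>
    intro x
    obtain ⟨g, hg⟩ := ih (lucchiniTowerProj t m x)
    obtain ⟨g', hg'⟩ := exists_lucchiniGroup_forall_le_apply_eq (m + 1)
      (Function.update g.1 (m + 1) x) (by
        intro n hn
        rcases eq_or_ne n m with rfl | hnm
        · rw [Function.update_self, Function.update_of_ne (by lia)]
          exact hg.symm
        · rw [Function.update_of_ne (by lia), Function.update_of_ne (by lia), g.2])
    exact ⟨g', (hg' _ le_rfl).trans (by simp)⟩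

/-- A nontrivial closed subgroup of Lucchini's group that is normalized by an open subgroup contains
the kernel of the projection to some group of the tower. -/
theorem exists_ker_lucchiniGroupProj_le {H M : Subgroup (lucchiniGroup t)}
    (hH : IsOpen (H : Set (lucchiniGroup t))) (hM : IsClosed (M : Set (lucchiniGroup t)))
    (hHM : ∀ x ∈ M, ∀ h ∈ H, h * x * h⁻¹ ∈ M) (hM1 : M ≠ ⊥) :
    ∃ n, (lucchiniGroupProj t n).ker ≤ M := by
  obtain ⟨m₁, hm₁⟩ := hH.exists_forall_lucchiniGroup_apply_eq H.one_mem
  obtain ⟨g, hgM, hg1⟩ := M.bot_or_exists_ne_one.resolve_left hM1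
  obtain ⟨m₂, hm₂⟩ : ∃ n, g.1 n ≠ 1 := by
    by_contra! h
    exact hg1 (Subtype.ext (funext h))
  -- From level `m` on, the kernels lie in `H` and `g` has nontrivial image.
  set m := max m₁ m₂
  have hmH (h : lucchiniGroup t) {n : ℕ} (hn : m ≤ n) (hh : lucchiniGroupProj t n h = 1) : h ∈ H :=
    hm₁ h (lucchiniGroup_apply_eq_of_le (h := 1) ((le_max_left _ _).trans hn) hh)
  have hg (n : ℕ) (hn : m ≤ n) : lucchiniGroupProj t n g ≠ 1 := fun h ↦
    hm₂ (lucchiniGroup_apply_eq_of_le (h := 1) ((le_max_right _ _).trans hn) h)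
  have hker (n : ℕ) (hn : m ≤ n) :
      (lucchiniTowerProj t n).ker ≤ M.map (lucchiniGroupProj t (n + 1)) := by
    refine ker_lucchiniTowerProj_le t n _ ?_ (Subgroup.mem_map_of_mem _ hgM) ?_
    · rintro _ ⟨x, hx, rfl⟩ k hk
      obtain ⟨h, rfl⟩ := lucchiniGroupProj_surjective (n + 1) k
      rw [MonoidHom.mem_ker, lucchiniTowerProj_lucchiniGroupProj] at hk
      exact ⟨h * x * h⁻¹, hHM x hx h (hmH h hn hk), by simp⟩
    · rw [lucchiniTowerProj_lucchiniGroupProj]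
      exact hg n hn
  refine ⟨m, fun k hk ↦ ?_⟩
  -- If `x` in `M` agrees with `k` at level `n`, the error `x⁻¹ * k` at level `n + 1` lies in the
  -- kernel of the tower projection, so an element of `M` corrects it. Closedness of `M` then yields
  -- `k ∈ M`.
  have happrox (n : ℕ) (hn : m ≤ n) : ∃ x ∈ M, lucchiniGroupProj t n x = lucchiniGroupProj t n k := by
    induction n, hn using Nat.le_induction with
    | base => exact ⟨1, M.one_mem, by rw [map_one, MonoidHom.mem_ker.1 hk]⟩
    | succ n hn ih =>
      obtain ⟨x, hx, hxk⟩ := ih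
      obtain ⟨y, hy, hyk⟩ := hker n hn (x := lucchiniGroupProj t (n + 1) (x⁻¹ * k)) (by
        rw [MonoidHom.mem_ker, lucchiniTowerProj_lucchiniGroupProj, map_mul, map_inv, hxk,
          inv_mul_cancel])
      refine ⟨x * y, M.mul_mem hx hy, ?_⟩
      rw [map_mul, hyk, map_mul, map_inv, mul_inv_cancel_left]
  by_contra hkM
  obtain ⟨n, hn⟩ := hM.isOpen_compl.exists_forall_lucchiniGroup_apply_eq hkM
  obtain ⟨x, hx, hxk⟩ := happrox (max m n) (le_max_left _ _)
  exact hn x (lucchiniGroup_apply_eq_of_le (le_max_right m n) hxk) hx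

/-! ### Embedding countably based profinite groups -/

theorem exists_isClosedEmbedding_lucchiniGroup (t : ℕ → ℕ+) (H : Type*) [Group H]
    [TopologicalSpace H] [IsTopologicalGroup H] [CompactSpace H] [TotallyDisconnectedSpace H]
    [SecondCountableTopology H] :
    ∃ f : H →* lucchiniGroup t, Topology.IsClosedEmbedding f := by
  obtain ⟨V, hV⟩ := exists_seq_openNormalSubgroup_forall_mem_imp_eq_one H
  have hψ (k n : ℕ) : ∃ ψ : H →* alternatingGroup (Fin (Nat.card (lucchiniTower t n))),
      IsLocallyConstant ψ ∧ (2 * Nat.card (H ⧸ (V k).toSubgroup) ≤ Nat.card (lucchiniTower t n) →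
        ∀ h, ψ h = 1 → h ∈ V k) := by
    by_cases hkn : 2 * Nat.card (H ⧸ (V k).toSubgroup) ≤ Nat.card (lucchiniTower t n)
    · obtain ⟨χ, hχ⟩ := exists_injective_hom_alternatingGroup _ hkn
      have : DiscreteTopology (H ⧸ (V k).toSubgroup) := QuotientGroup.discreteTopology (V k).isOpen
      refine ⟨χ.comp (QuotientGroup.mk' _), ?_, fun _ h hh ↦ ?_⟩
      · exact ((IsLocallyConstant.iff_continuous _).2 QuotientGroup.continuous_mk).comp χ
      · exact (QuotientGroup.eq_one_iff h).1 (hχ (hh.trans χ.map_one.symm))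
    · exact ⟨1, IsLocallyConstant.const 1, fun h ↦ absurd h hkn⟩
  choose ψ hψc hψV using hψ
  -- Unpairing assigns each `k` to infinitely many levels `n`, hence to one where the alternating
  -- group is large enough for the quotient by `V k`.
  let φ := lucchiniTowerLift t fun n ↦ ψ n.unpair.1 n
  have hφc (n : ℕ) : IsLocallyConstant (φ n) := by
    induction n with
    | zero => exact IsLocallyConstant.const 1
    | succ n ih =>
      exact (hψc n.unpair.1 n).comp₂ ih fun a x ↦ subdirectPowerDiag _ _ (t n) (a, x)
  let f : H →* lucchiniGroup t := (MonoidHom.pi φ).codRestrict _ fun h n ↦ rfl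
  refine ⟨f, Continuous.isClosedEmbedding ?_ ?_⟩
  · exact Continuous.subtype_mk (continuous_pi fun n ↦ (hφc n).continuous) _
  · rw [injective_iff_map_eq_one]
    refine fun h hh ↦ hV h fun k ↦ ?_
    -- This level is assigned to `k` and is at least `2 * |H / V k|`, so `ψ k n` is faithful modulo
    -- `V k`.
    set n := Nat.pair k (2 * Nat.card (H ⧸ (V k).toSubgroup)) with hn
    have hcard := card_lucchiniTower_lower_bound t n
    have hle := Nat.right_le_pair k (2 * Nat.card (H ⧸ (V k).toSubgroup))
    refine hψV k n (by lia) h ?_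
    have hφ : φ (n + 1) h = 1 := congrFun (congrArg Subtype.val hh) (n + 1)
    have hpair := subdirectPowerDiag_injective (hφ.trans (map_one (subdirectPowerDiag _ _ _)).symm)
    have hfst : ψ n.unpair.1 n h = 1 := congrArg Prod.fst hpair
    rwa [hn, Nat.unpair_pair, ← hn] at hfst

theorem infinite_lucchiniGroup (t : ℕ → ℕ+) : Infinite (lucchiniGroup t) := by
  have : Nontrivial ℤˣ := ⟨1, -1, by decide⟩
  obtain ⟨f, hf⟩ := exists_isClosedEmbedding_lucchiniGroup t (ℕ → ℤˣ)
  exact Infinite.of_injective f hf.injective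

theorem isHereditarilyJustInfinite_lucchiniGroup (t : ℕ → ℕ+) :
    IsHereditarilyJustInfinite (lucchiniGroup t) := by
  intro H hH
  refine ⟨?_, fun N hN hNc hN1 ↦ ?_⟩
  · have := infinite_lucchiniGroup t
    have : Finite (lucchiniGroup t ⧸ H) := H.quotient_finite_of_isOpen hH
    by_contra hfin
    rw [not_infinite_iff_finite] at hfin
    exact not_finite_iff_infinite.2 ‹_›
      (Finite.of_equiv _ (Subgroup.groupEquivQuotientProdSubgroup (s := H)).symm)
  -- Open subgroups are closed, so `N` remains closed in the whole group, where it is normalized by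
  -- `H`.
  · obtain ⟨n, hn⟩ := exists_ker_lucchiniGroupProj_le (M := N.map H.subtype) hH
      ((H.isClosed_of_isOpen hH).isClosedEmbedding_subtypeVal.isClosedMap _ hNc) (by
        rintro _ ⟨x, hx, rfl⟩ h hh
        exact ⟨⟨h, hh⟩ * x * ⟨h, hh⟩⁻¹, hN.conj_mem x hx _, rfl⟩)
      (by rwa [ne_eq, Subgroup.map_eq_bot_iff_of_injective _ H.subtype_injective])
    have : (N.map H.subtype).FiniteIndex := Subgroup.finiteIndex_of_le hn
    have hcomap : (N.map H.subtype).subgroupOf H = N :=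
      Subgroup.comap_map_eq_self_of_injective H.subtype_injective N
    rw [← hcomap]
    infer_instance

end Group

theorem mainTheorem1 (t : ℕ → ℕ+) :
    (IsTopologicalGroup (lucchiniGroup t) ∧ CompactSpace (lucchiniGroup t) ∧
      TotallyDisconnectedSpace (lucchiniGroup t)) ∧
    IsHereditarilyJustInfinite (lucchiniGroup t) ∧
    ∀ (H : Type*) [Group H] [TopologicalSpace H] [IsTopologicalGroup H] [CompactSpace H]
      [TotallyDisconnectedSpace H] [SecondCountableTopology H],
      ∃ f : H →* lucchiniGroup t, Topology.IsClosedEmbedding f :=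
  ⟨⟨inferInstance, inferInstance, inferInstance⟩, isHereditarilyJustInfinite_lucchiniGroup t,
    fun H ↦ exists_isClosedEmbedding_lucchiniGroup t H⟩
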